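/- Let $\mathcal X$ be a standard Borel space, $\mathcal Y,\mathcal Z,\mathcal U$ measurable spaces, $(Y,X)$ a random pair in $\mathcal Y\times\mathcal X$ with joint law $P_{Y,X}$ and first marginal $P_Y$, and let $P^{\mathrm{ref}}_Z$, $P_U$ be reference probability measures on $\mathcal Z$ and $\mathcal U$. Let $c_{\mathcal X}:\mathcal X\times\mathcal X\to[0,\infty)$ be a measurable cost and let $$W_{c_{\mathcal X}}(\mu,\nu)=\inf_{\pi}\int c_{\mathcal X}(x,x')\,\pi(dx,dx')\in[0,\infty],$$ the infimum being over all couplings $\pi$ of $\mu$ and $\nu$. For a measurable encoder $\Phi_{\mathcal Y}:\mathcal Y\to\mathcal Z$ put $Z=\Phi_{\mathcal Y}(Y)$, write $P_Z=\Phi_{\mathcal Y}\#P_Y$ for its law, and let $P_{X\mid Y=y}$, $P_{X\mid Z=z}$ be the regular conditional distributions. For a measurable map $\overline G_{\mathcal X}:\mathcal Z\times\mathcal U\to\mathcal X$ define $$\mathcal R_Z=\int_{\mathcal Z} W_{c_{\mathcal X}}\bigl(P_{X\mid Z=z},\overline G_{\mathcal X}(z,\cdot)\#P_U\bigr)P_Z(dz),\qquad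 \mathcal R_Y=\int_{\mathcal Y} W_{c_{\mathcal X}}\bigl(P_{X\mid Y=y},\overline G_{\mathcal X}(\Phi_{\mathcal Y}(y),\cdot)\#P_U\bigr)P_Y(dy),$$ $$\mathcal E(\Phi_{\mathcal Y})=\int_{\mathcal Y} W_{c_{\mathcal X}}\bigl(P_{X\mid Y=y},P_{X\mid Z=\Phi_{\mathcal Y}(y)}\bigr)P_Y(dy).$$ Call $\Phi_{\mathcal Y}$ exact if there are measurable maps $G_{\mathcal Y}:\mathcal Z\to\mathcal Y$ and $G'_{\mathcal X}:\mathcal Z\times\mathcal U\to\mathcal X$ such that $G(z,u)=(G_{\mathcal Y}(z),G'_{\mathcal X}(z,u))$ satisfies $G\#(P^{\mathrm{ref}}_Z\otimes P_U)=P_{Y,X}$, and a measurable set $S\subseteq\mathcal Y$ with $P_Y(S)=1$, $\Phi_{\mathcal Y}(G_{\mathcal Y}(z))=z$ for all $z\in G_{\mathcal Y}^{-1}(S)$, and $G_{\mathcal Y}(\Phi_{\mathcal Y}(y))=y$ for all $y\in S$. Then, for every measurable $\Phi_{\mathcal Y}$ and $\overline G_{\mathcal X}$, the three integrands are measurable up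 to null sets (so $\mathcal R_Z,\mathcal R_Y,\mathcal E(\Phi_{\mathcal Y})\in[0,\infty]$ are well defined), and: 1. $\mathcal R_Z\le\mathcal R_Y$. 2. If $c_{\mathcal X}$ satisfies the triangle inequality $c_{\mathcal X}(x,x'')\le c_{\mathcal X}(x,x')+c_{\mathcal X}(x',x'')$, then $\mathcal R_Y\le\mathcal R_Z+\mathcal E(\Phi_{\mathcal Y})$. 3. If $\Phi_{\mathcal Y}$ is exact, then $\mathcal R_Y=\mathcal R_Z$; if moreover $c_{\mathcal X}(x,x)=0$ for all $x$, then $\mathcal E(\Phi_{\mathcal Y})=0$. -/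

import Mathlib

open MeasureTheory ProbabilityTheory
open scoped NNReal ENNReal

namespace CondOT

variable {𝒳 𝒴 𝒵 𝒰 : Type*} [MeasurableSpace 𝒳] [MeasurableSpace 𝒴] [MeasurableSpace 𝒵]
  [MeasurableSpace 𝒰]

/-- Optimal transport cost `W_c(μ, ν)`: the infimum of `∫ c dπ` over all couplings `π` of `μ`
and `ν`, with values in `[0, ∞]`. -/
noncomputable def otCost (c : 𝒳 → 𝒳 → ℝ≥0) (μ ν : Measure 𝒳) : ℝ≥0∞ :=
  ⨅ (π : Measure (𝒳 × 𝒳)) (_ : π.fst = μ ∧ π.snd = ν), ∫⁻ p, (c p.1 p.2 : ℝ≥0∞) ∂π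

/-- The law `Ḡ(z, ·) # P_U` generated at the latent code `z`. -/
noncomputable def genLaw (G : 𝒵 × 𝒰 → 𝒳) (PU : Measure 𝒰) (z : 𝒵) : Measure 𝒳 :=
  PU.map (fun u => G (z, u))

/-- The joint law `P_{Z,X}` of `(Z, X)` with `Z = Φ(Y)`, where `(Y, X)` has joint law `P`. -/
noncomputable def latentJoint (P : Measure (𝒴 × 𝒳)) (Φ : 𝒴 → 𝒵) : Measure (𝒵 × 𝒳) :=
  P.map (fun p => (Φ p.1, p.2))

instance (P : Measure (𝒴 × 𝒳)) [IsFiniteMeasure P] (Φ : 𝒴 → 𝒵) :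
    IsFiniteMeasure (latentJoint P Φ) := by
  unfold latentJoint; infer_instance

section Costs

variable [StandardBorelSpace 𝒳] [Nonempty 𝒳]

/-- The conditional distribution `P_{X ∣ Y = y}`. -/
noncomputable def condY (P : Measure (𝒴 × 𝒳)) [IsFiniteMeasure P] (y : 𝒴) : Measure 𝒳 :=
  P.condKernel y

/-- The conditional distribution `P_{X ∣ Z = z}`, with `Z = Φ(Y)`. -/
noncomputable def condZ (P : Measure (𝒴 × 𝒳)) [IsFiniteMeasure P] (Φ : 𝒴 → 𝒵) (z : 𝒵) :
    Measure 𝒳 :=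
  (latentJoint P Φ).condKernel z

/-- Latent conditional OT cost
`R_Z = ∫ W_c(P_{X ∣ Z = z}, Ḡ(z, ·) # P_U) P_Z(dz)`, where `P_Z = Φ # P_Y`. -/
noncomputable def latentCost (c : 𝒳 → 𝒳 → ℝ≥0) (P : Measure (𝒴 × 𝒳)) [IsFiniteMeasure P]
    (PU : Measure 𝒰) (G : 𝒵 × 𝒰 → 𝒳) (Φ : 𝒴 → 𝒵) : ℝ≥0∞ :=
  ∫⁻ z, otCost c (condZ P Φ z) (genLaw G PU z) ∂(P.fst.map Φ)

/-- Conditional OT cost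
`R_Y = ∫ W_c(P_{X ∣ Y = y}, Ḡ(Φ(y), ·) # P_U) P_Y(dy)`. -/
noncomputable def condCost (c : 𝒳 → 𝒳 → ℝ≥0) (P : Measure (𝒴 × 𝒳)) [IsFiniteMeasure P]
    (PU : Measure 𝒰) (G : 𝒵 × 𝒰 → 𝒳) (Φ : 𝒴 → 𝒵) : ℝ≥0∞ :=
  ∫⁻ y, otCost c (condY P y) (genLaw G PU (Φ y)) ∂P.fst

/-- Conditional representation error
`E(Φ) = ∫ W_c(P_{X ∣ Y = y}, P_{X ∣ Z = Φ(y)}) P_Y(dy)`. -/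
noncomputable def reprError (c : 𝒳 → 𝒳 → ℝ≥0) (P : Measure (𝒴 × 𝒳)) [IsFiniteMeasure P]
    (Φ : 𝒴 → 𝒵) : ℝ≥0∞ :=
  ∫⁻ y, otCost c (condY P y) (condZ P Φ (Φ y)) ∂P.fst

end Costs

/-- `Φ` is an inverse of `GY` on a set of full `PY`-measure. -/
def IsInverseOnSupport (PY : Measure 𝒴) (GY : 𝒵 → 𝒴) (Φ : 𝒴 → 𝒵) : Prop :=
  ∃ S : Set 𝒴, MeasurableSet S ∧ PY S = 1 ∧
    (∀ z ∈ GY ⁻¹' S, Φ (GY z) = z) ∧ (∀ y ∈ S, GY (Φ y) = y)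

/-- `Φ` is an exact encoder for the joint law `P` and the reference law `PZref ⊗ PU`: there is a
generator `G(z, u) = (GY z, GX (z, u))` with `G # (PZref ⊗ PU) = P` such that `Φ` is an inverse
of `GY` on a set of full `P_Y`-measure. -/
def IsExactEncoder (P : Measure (𝒴 × 𝒳)) (PZref : Measure 𝒵) (PU : Measure 𝒰)
    (Φ : 𝒴 → 𝒵) : Prop :=
  ∃ (GY : 𝒵 → 𝒴) (GX : 𝒵 × 𝒰 → 𝒳), Measurable GY ∧ Measurable GX ∧
    (PZref.prod PU).map (fun q => (GY q.1, GX q)) = P ∧ IsInverseOnSupport P.fst GY Φ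

end CondOT

open Set Filter Topology

/-! ### Analytic sets: universal measurability and measurable sections -/

namespace BaireSection

variable {F : Type*}

/-! Conditioning on `Z` averages the laws given `Y` along the fibres of `Φ`, while the generated law
depends on `y` only through `Φ y`. Averaging almost optimal couplings over a fibre therefore couples
the two laws compared at `z`, at the averaged cost: this is the first inequality
(`lintegral_otCost_condZ_le`). The second integrates the triangle inequality for transport costs,
obtained by gluing couplings (`otCost_triangle`). For an exact encoder, `Y` is almost surely a
function of `Z`, so both conditional laws agree almost everywhere (`condY_ae_eq_condZ`).

The main difficulty is measurability: the cost is an infimum over uncountably many couplings, and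
averaging needs couplings that depend measurably on `y`. Probability measures on `𝒳 × 𝒳` are coded
by points of `ℚ → ℝ` (`exists_universal_kernel`), which turns the set where the cost is below `r`
into the preimage of an analytic set. Such sets are universally measurable and carry almost
everywhere measurable sections (`exists_measurable_section`); this yields both `aemeasurable_otCost`
and `exists_kernel_coupling_le`. -/

theorem exists_forall_lt_measure_image [MeasurableSpace F] (ρ : Measure F) (φ : (ℕ → ℕ) → F)
    {r : ℝ≥0∞} (hr : r < ρ (range φ)) :
    ∃ b : ℕ → ℕ, ∀ n, r < ρ (φ '' {x | ∀ i < n, x i ≤ b i}) := by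
  have step : ∀ (n : ℕ) (A : {A : Set (ℕ → ℕ) // r < ρ (φ '' A)}),
      ∃ m : ℕ, r < ρ (φ '' (A.1 ∩ {x | x n ≤ m})) := by
    intro n A
    have hmono : Monotone fun m : ℕ => φ '' (A.1 ∩ {x | x n ≤ m}) := fun m m' h =>
      image_mono fun x hx => ⟨hx.1, hx.2.trans h⟩
    have hU : (⋃ m : ℕ, φ '' (A.1 ∩ {x | x n ≤ m})) = φ '' A.1 := by
      rw [← image_iUnion, ← inter_iUnion]
      congr 1
      exact inter_eq_left.2 fun x _ => mem_iUnion.2 ⟨x n, le_refl (x n)⟩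
    have := A.2
    -- Continuity from below holds for outer measure on arbitrary sets, so the images need not be
    -- known to be measurable.
    rw [← hU, hmono.measure_iUnion] at this
    exact lt_iSup_iff.1 this
  choose f hf using step
  let S : ℕ → {A : Set (ℕ → ℕ) // r < ρ (φ '' A)} := fun n =>
    Nat.rec ⟨univ, by rwa [image_univ]⟩ (fun k A => ⟨A.1 ∩ {x | x k ≤ f k A}, hf k A⟩) n
  refine ⟨fun n => f n (S n), fun n => ?_⟩
  have hS : ∀ n, (S n).1 = {x | ∀ i < n, x i ≤ f i (S i)} := by
    intro n
    induction n with
    | zero => ext x; simp [S]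
    | succ k ih =>
      have : (S (k + 1)).1 = (S k).1 ∩ {x | x k ≤ f k (S k)} := rfl
      rw [this, ih]
      ext x
      simp only [mem_inter_iff, mem_ofPred_eq, Nat.lt_succ_iff_lt_or_eq, or_imp, forall_and,
        forall_eq]
  rw [← hS]
  exact (S n).2

theorem isCompact_box (b : ℕ → ℕ) : IsCompact (Iic b) := by
  have : Iic b = Icc 0 b := by ext x; simp
  rw [this]
  exact isCompact_Icc

/-- Points whose images approach `y` are bounded by `b` on longer and longer prefixes. Truncating
them at `b` puts them in a compact box without changing those prefixes, so a subsequence of the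
original points converges too, to a preimage of `y`. -/
theorem iInter_closure_image_subset [TopologicalSpace F] [TopologicalSpace.MetrizableSpace F]
    {φ : (ℕ → ℕ) → F} (hφ : Continuous φ) (b : ℕ → ℕ) :
    (⋂ n, closure (φ '' {x | ∀ i < n, x i ≤ b i})) ⊆ φ '' Iic b := by
  let _ := TopologicalSpace.metrizableSpaceMetric F
  intro y hy
  rw [mem_iInter] at hy
  have : ∀ n : ℕ, ∃ x : ℕ → ℕ, (∀ i < n, x i ≤ b i) ∧ dist y (φ x) < 1 / ((n : ℝ) + 1) := by
    intro n
    obtain ⟨_, ⟨x, hx, rfl⟩, h⟩ := Metric.mem_closure_iff.1 (hy n) _ Nat.one_div_pos_of_nat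
    exact ⟨x, hx, h⟩
  choose x hx hd using this
  obtain ⟨a, ha, s, hs, hlim⟩ := (isCompact_box b).tendsto_subseq
    (x := fun n => x n ⊓ b) (fun n => mem_Iic.2 inf_le_right)
  have hlim' : Tendsto (x ∘ s) atTop (𝓝 a) := by
    rw [tendsto_pi_nhds] at hlim ⊢
    intro i
    refine (hlim i).congr' ?_
    filter_upwards [eventually_gt_atTop i] with n hn
    exact inf_eq_left.2 (hx (s n) i (hn.trans_le hs.le_apply))
  refine ⟨a, ha, tendsto_nhds_unique ((hφ.tendsto a).comp hlim') ?_⟩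
  refine Tendsto.comp (g := fun n => φ (x n)) ?_ hs.tendsto_atTop
  rw [tendsto_iff_dist_tendsto_zero]
  refine squeeze_zero (fun _ => dist_nonneg) (fun n => ?_) tendsto_one_div_add_atTop_nhds_zero_nat
  rw [dist_comm]
  exact (hd n).le

/-- The continuous image of Baire space is capacitable for every finite measure. -/
theorem exists_le_measure_image_box [TopologicalSpace F] [TopologicalSpace.MetrizableSpace F]
    [MeasurableSpace F] [BorelSpace F] (ρ : Measure F) [IsFiniteMeasure ρ]
    {φ : (ℕ → ℕ) → F} (hφ : Continuous φ) {r : ℝ≥0∞} (hr : r < ρ (range φ)) :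
    ∃ b : ℕ → ℕ, r ≤ ρ (φ '' Iic b) := by
  obtain ⟨b, hb⟩ := exists_forall_lt_measure_image ρ φ hr
  refine ⟨b, le_trans ?_ (measure_mono (iInter_closure_image_subset hφ b))⟩
  rw [Antitone.measure_iInter]
  · exact le_iInf fun n => (hb n).le.trans (measure_mono subset_closure)
  · intro m n hmn
    exact closure_mono (image_mono fun x hx i hi => hx i (hi.trans_le hmn))
  · exact fun n => isClosed_closure.measurableSet.nullMeasurableSet
  · exact ⟨0, measure_ne_top _ _⟩

/-! ### Least branches and measurable selection -/

section LexMin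

variable (C : List ℕ → Set F)

/-- Reversed initial segments of the lexicographically least branch through the tree of all `σ`
with `y ∈ C σ`. -/
noncomputable def lexPrefix (y : F) : ℕ → List ℕ
  | 0 => []
  | n + 1 => sInf {m | y ∈ C (m :: lexPrefix y n)} :: lexPrefix y n

/-- The lexicographically least branch through the tree of all `σ` with `y ∈ C σ`. -/
noncomputable def lexBranch (y : F) (n : ℕ) : ℕ := sInf {m | y ∈ C (m :: lexPrefix C y n)}

theorem res_lexBranch (y : F) (n : ℕ) : PiNat.res (lexBranch C y) n = lexPrefix C y n := by
  induction n with
  | zero => rfl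
  | succ n ih => rw [PiNat.res_succ, ih]; rfl

variable {C}

theorem mem_lexPrefix {y : F} (h0 : y ∈ C []) (hC : ∀ σ, C σ ⊆ ⋃ m, C (m :: σ)) (n : ℕ) :
    y ∈ C (lexPrefix C y n) := by
  induction n with
  | zero => exact h0
  | succ n ih => exact Nat.sInf_mem (s := {m | y ∈ C (m :: lexPrefix C y n)}) (mem_iUnion.1 (hC _ ih))

variable [MeasurableSpace F]

theorem measurable_sInf_nat {D : ℕ → Set F} (hD : ∀ m, MeasurableSet (D m)) :
    Measurable fun y => sInf {m | y ∈ D m} := by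
  refine measurable_of_Iic fun k => ?_
  -- The complement appears because `sInf ∅ = 0` in `ℕ`.
  have : (fun y => sInf {m | y ∈ D m}) ⁻¹' Iic k = (⋃ m ≤ k, D m) ∪ (⋃ m, D m)ᶜ := by
    ext y
    simp only [mem_preimage, mem_Iic, mem_union, mem_iUnion, mem_compl_iff, exists_prop]
    by_cases h : ∃ m, y ∈ D m
    · refine ⟨fun hk => Or.inl ⟨_, hk, Nat.sInf_mem (s := {m | y ∈ D m}) h⟩, ?_⟩
      rintro (⟨m, hm, hy⟩ | h')
      · exact (Nat.sInf_le (s := {m | y ∈ D m}) hy).trans hm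
      · exact absurd h h'
    · have : {m | y ∈ D m} = ∅ := eq_empty_of_forall_notMem fun m hm => h ⟨m, hm⟩
      simp [this, h]
  rw [this]
  exact (MeasurableSet.biUnion (to_countable _) fun m _ => hD m).union
    (MeasurableSet.iUnion hD).compl

theorem measurableSet_lexPrefix_eq (hC : ∀ σ, MeasurableSet (C σ)) (n : ℕ) (σ : List ℕ) :
    MeasurableSet {y | lexPrefix C y n = σ} := by
  induction n generalizing σ with
  | zero => simp [lexPrefix]
  | succ n ih =>
    cases σ with
    | nil => simp [lexPrefix]
    | cons m τ =>
      have : {y | lexPrefix C y (n + 1) = m :: τ} =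
          {y | lexPrefix C y n = τ} ∩ (fun y => sInf {m | y ∈ C (m :: τ)}) ⁻¹' {m} := by
        ext y
        simp only [lexPrefix, List.cons.injEq, mem_ofPred_eq, mem_inter_iff, mem_preimage,
          mem_singleton_iff]
        constructor
        · rintro ⟨h1, h2⟩; subst h2; exact ⟨rfl, h1⟩
        · rintro ⟨h2, h1⟩; subst h2; exact ⟨h1, rfl⟩
      rw [this]
      exact (ih τ).inter (measurable_sInf_nat (fun m => hC _) (measurableSet_singleton _))

theorem measurable_lexBranch (hC : ∀ σ, MeasurableSet (C σ)) : Measurable (lexBranch C) := by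
  refine measurable_pi_lambda _ fun n => measurable_to_countable' fun m => ?_
  have : (fun y => lexBranch C y n) ⁻¹' {m} = ⋃ σ : List ℕ,
      {y | lexPrefix C y (n + 1) = m :: σ} := by
    ext y
    simp [lexPrefix, lexBranch]
  rw [this]
  exact MeasurableSet.iUnion fun σ => measurableSet_lexPrefix_eq hC _ _

end LexMin

theorem isClosed_res_eq (n : ℕ) (σ : List ℕ) : IsClosed {x : ℕ → ℕ | PiNat.res x n = σ} := by
  rcases eq_empty_or_nonempty {x : ℕ → ℕ | PiNat.res x n = σ} with h | ⟨x₀, h₀⟩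
  · rw [h]; exact isClosed_empty
  · have : {x : ℕ → ℕ | PiNat.res x n = σ} = ⋂ (i) (_ : i < n), {x | x i = x₀ i} := by
      ext x
      have h₀ : PiNat.res x₀ n = σ := h₀
      simp only [mem_ofPred_eq, mem_iInter, ← h₀, PiNat.res_eq_res]
    rw [this]
    exact isClosed_biInter fun i _ => isClosed_eq (continuous_apply i) continuous_const

/-- The section is the lexicographically least branch of the tree of prefixes `σ` for which `y` has
a preimage in `K` extending `σ`. Compactness makes each `C σ` closed, hence the branch measurable.
Preimages of `y` sharing ever longer prefixes with the branch converge to it, so continuity makes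
the branch a preimage. -/
theorem exists_measurable_section_on_compact [TopologicalSpace F] [T2Space F]
    [MeasurableSpace F] [BorelSpace F] {φ : (ℕ → ℕ) → F} (hφ : Continuous φ) {K : Set (ℕ → ℕ)}
    (hK : IsCompact K) : ∃ t : F → ℕ → ℕ, Measurable t ∧ ∀ y ∈ φ '' K, φ (t y) = y := by
  let C : List ℕ → Set F := fun σ => φ '' (K ∩ {x | PiNat.res x σ.length = σ})
  have hCm : ∀ σ, MeasurableSet (C σ) := fun σ =>
    ((hK.inter_right (isClosed_res_eq _ _)).image hφ).isClosed.measurableSet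
  have hC : ∀ σ, C σ ⊆ ⋃ m, C (m :: σ) := by
    rintro σ _ ⟨x, ⟨hxK, hx⟩, rfl⟩
    refine mem_iUnion.2 ⟨x σ.length, x, ⟨hxK, ?_⟩, rfl⟩
    have hx : PiNat.res x σ.length = σ := hx
    simp only [List.length_cons, mem_ofPred_eq, PiNat.res_succ, hx]
  refine ⟨lexBranch C, measurable_lexBranch hCm, fun y hy => ?_⟩
  have h0 : y ∈ C [] := by
    obtain ⟨x, hx, rfl⟩ := hy
    exact ⟨x, ⟨hx, rfl⟩, rfl⟩
  have key : ∀ n, ∃ x, φ x = y ∧ PiNat.res x n = PiNat.res (lexBranch C y) n := by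
    intro n
    obtain ⟨x, ⟨-, hx⟩, hxy⟩ := mem_lexPrefix h0 hC n
    refine ⟨x, hxy, ?_⟩
    have hx : PiNat.res x (lexPrefix C y n).length = lexPrefix C y n := hx
    rw [← res_lexBranch, PiNat.res_length] at hx
    exact hx
  choose x hxy hx using key
  have hlim : Tendsto x atTop (𝓝 (lexBranch C y)) := by
    rw [tendsto_pi_nhds]
    intro i
    refine tendsto_const_nhds.congr' ?_
    filter_upwards [eventually_gt_atTop i] with n hn
    exact (PiNat.res_eq_res.1 (hx n) hn).symm
  refine tendsto_nhds_unique ((hφ.tendsto _).comp hlim) ?_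
  have : φ ∘ x = fun _ => y := funext hxy
  rw [this]
  exact tendsto_const_nhds

/-- A continuous image of Baire space is universally measurable, and the map has a measurable
section almost everywhere on its range. -/
theorem exists_measurable_section_of_continuous [TopologicalSpace F]
    [TopologicalSpace.MetrizableSpace F] [MeasurableSpace F] [BorelSpace F] (ρ : Measure F)
    [IsFiniteMeasure ρ] {φ : (ℕ → ℕ) → F} (hφ : Continuous φ) :
    ∃ (B : Set F) (t : F → ℕ → ℕ), MeasurableSet B ∧ B ⊆ range φ ∧ B =ᵐ[ρ] range φ ∧
      Measurable t ∧ ∀ y ∈ B, φ (t y) = y := by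
  have hex : ∀ n : ℕ, ∃ b : ℕ → ℕ, ρ (range φ) - ((n : ℝ≥0∞) + 1)⁻¹ ≤ ρ (φ '' Iic b) := by
    intro n
    rcases eq_or_ne (ρ (range φ)) 0 with h | h
    · exact ⟨0, by simp [h]⟩
    · refine exists_le_measure_image_box ρ hφ (ENNReal.sub_lt_self (measure_ne_top _ _) h ?_)
      simp
  choose b hb using hex
  choose t htm ht using fun n =>
    exists_measurable_section_on_compact hφ (isCompact_box (b n))
  have hm : ∀ n, MeasurableSet (φ '' Iic (b n)) := fun n =>
    ((isCompact_box (b n)).image hφ).isClosed.measurableSet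
  have hsub : (⋃ n, φ '' Iic (b n)) ⊆ range φ := iUnion_subset fun n => image_subset_range _ _
  -- Images of compact boxes exhaust the range up to a null set; the sections over them are glued by
  -- using the least index whose image contains `y`.
  refine ⟨⋃ n, φ '' Iic (b n), fun y => t (sInf {n | y ∈ φ '' Iic (b n)}) y,
    MeasurableSet.iUnion hm, hsub, ?_, ?_, ?_⟩
  · refine ae_eq_of_subset_of_measure_ge hsub ?_ (MeasurableSet.iUnion hm).nullMeasurableSet
      (measure_ne_top _ _)
    have hlim : Tendsto (fun n : ℕ => ρ (range φ) - ((n : ℝ≥0∞) + 1)⁻¹) atTop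
        (𝓝 (ρ (range φ) - 0)) := by
      refine ENNReal.Tendsto.sub tendsto_const_nhds ?_ (Or.inl (measure_ne_top _ _))
      have := (tendsto_add_atTop_iff_nat 1).2 ENNReal.tendsto_inv_nat_nhds_zero
      simpa using this
    rw [tsub_zero] at hlim
    exact le_of_tendsto' hlim fun n =>
      (hb n).trans (measure_mono (subset_iUnion (fun n => φ '' Iic (b n)) n))
  · have h1 : Measurable fun p : ℕ × F => t p.1 p.2 := measurable_from_prod_countable_right htm
    exact h1.comp ((measurable_sInf_nat hm).prodMk measurable_id)
  · intro y hy
    exact ht _ y (Nat.sInf_mem (s := {n | y ∈ φ '' Iic (b n)}) (mem_iUnion.1 hy))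

theorem exists_measurable_surjective_continuous_comp [MeasurableSpace F] [TopologicalSpace F]
    [SecondCountableTopology F] [BorelSpace F] {E : Type*} [MeasurableSpace E]
    [StandardBorelSpace E] [Nonempty E] {g : E → F} (hg : Measurable g) :
    ∃ ψ : (ℕ → ℕ) → E, Measurable ψ ∧ Function.Surjective ψ ∧ Continuous (g ∘ ψ) := by
  let _ := upgradeStandardBorel E
  suffices ∃ ψ : (ℕ → ℕ) → E, Continuous ψ ∧ Function.Surjective ψ ∧ Continuous (g ∘ ψ) by
    obtain ⟨ψ, hψ, h⟩ := this
    exact ⟨ψ, hψ.measurable, h⟩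
  -- A finer Polish topology makes `g` continuous.
  obtain ⟨τ, hτ, hgc, hτp⟩ := hg.exists_continuous
  obtain ⟨ψ, hψ, hψs⟩ := @PolishSpace.exists_nat_nat_continuous_surjective E τ hτp _
  exact ⟨ψ, continuous_le_rng hτ hψ, hψs, @Continuous.comp _ _ _ _ τ _ _ _ hgc hψ⟩

/-- The image of a measurable set under a measurable map between standard Borel spaces is
universally measurable, and the map has a measurable section almost everywhere on the image. -/
theorem exists_measurable_section [MeasurableSpace F] [StandardBorelSpace F] {E : Type*}
    [MeasurableSpace E] [StandardBorelSpace E] [Nonempty E] (ρ : Measure F) [IsFiniteMeasure ρ]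
    {g : E → F} (hg : Measurable g) {A : Set E} (hA : MeasurableSet A) :
    NullMeasurableSet (g '' A) ρ ∧
      ∃ t : F → E, Measurable t ∧ ∀ᵐ y ∂ρ, y ∈ g '' A → t y ∈ A ∧ g (t y) = y := by
  rcases eq_empty_or_nonempty A with rfl | hne
  · simp only [image_empty]
    exact ⟨MeasurableSet.empty.nullMeasurableSet, fun _ => Classical.arbitrary E,
      measurable_const, by simp⟩
  have := hA.standardBorel
  have := hne.to_subtype
  let _ := upgradeStandardBorel F
  obtain ⟨ψ, hψ, hψs, hc⟩ := exists_measurable_surjective_continuous_comp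
    (hg.comp (measurable_subtype_coe (p := (· ∈ A))))
  have hr : range ((g ∘ (Subtype.val : A → E)) ∘ ψ) = g '' A := by
    rw [hψs.range_comp, range_comp, Subtype.range_coe]
  obtain ⟨B, t, hB, -, hBr, htm, ht⟩ := exists_measurable_section_of_continuous ρ hc
  rw [hr] at hBr
  refine ⟨hB.nullMeasurableSet.congr hBr, fun y => ψ (t y),
    measurable_subtype_coe.comp (hψ.comp htm), ?_⟩
  filter_upwards [hBr.mem_iff] with y hy hyA
  exact ⟨(ψ (t y)).2, ht y (hy.2 hyA)⟩

end BaireSection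

/-! ### Coding measures by points and by countably many values -/

theorem measure_stieltjesOfMeasurableRat_cdf (μ : Measure ℝ) [IsProbabilityMeasure μ] :
    (stieltjesOfMeasurableRat (id : (ℚ → ℝ) → ℚ → ℝ) measurable_id
      (fun q => cdf μ q)).measure = μ := by
  set e : ℚ → ℝ := fun q => cdf μ q with he
  have hpt : IsRatStieltjesPoint (id : (ℚ → ℝ) → ℚ → ℝ) e := by
    refine ⟨fun a b h => monotone_cdf μ (by exact_mod_cast h), ?_, ?_, fun t => ?_⟩
    · exact (tendsto_cdf_atTop μ).comp (tendsto_ratCast_atTop_iff.2 tendsto_id)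
    · exact (tendsto_cdf_atBot μ).comp (tendsto_ratCast_atBot_iff.2 tendsto_id)
    · rw [← show _ = id e t from (cdf μ).iInf_rat_gt_eq t]
      exact (Equiv.subtypeEquivRight fun q : ℚ => by simp).iInf_congr fun _ => rfl
  refine Measure.ext_of_Iic _ _ fun a => ?_
  rw [measure_stieltjesOfMeasurableRat_Iic, ← ofReal_cdf]
  congr 1
  rw [← StieltjesFunction.iInf_rat_gt_eq, ← (cdf μ).iInf_rat_gt_eq]
  congr 1
  ext r
  rw [stieltjesOfMeasurableRat_eq, toRatCDF_of_isRatStieltjesPoint hpt]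
  rfl

/-- A Markov kernel from a standard Borel space whose values are all the probability measures on
`α`. -/
theorem exists_universal_kernel (α : Type*) [MeasurableSpace α] [StandardBorelSpace α]
    [Nonempty α] : ∃ κ : Kernel (ℚ → ℝ) α, IsMarkovKernel κ ∧
      ∀ μ : Measure α, IsProbabilityMeasure μ → ∃ e, κ e = μ := by
  let κ₀ : Kernel (ℚ → ℝ) ℝ :=
    ⟨fun e => (stieltjesOfMeasurableRat id measurable_id e).measure,
      measurable_measure_stieltjesOfMeasurableRat measurable_id⟩
  have : IsMarkovKernel κ₀ := ⟨fun e =>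
    instIsProbabilityMeasure_stieltjesOfMeasurableRat measurable_id e⟩
  have hf := measurableEmbedding_embeddingReal α
  have hs : MeasurableSet {e | κ₀.comapRight hf e univ = 1} :=
    (κ₀.comapRight hf).measurable_coe MeasurableSet.univ (measurableSet_singleton 1)
  classical
  -- Pulling back along the embedding loses mass when the real measure charges the complement of its
  -- range; a Dirac mass replaces those values.
  let κ : Kernel (ℚ → ℝ) α := Kernel.piecewise hs (κ₀.comapRight hf)
    (Kernel.const _ (Measure.dirac (Classical.arbitrary α)))
  refine ⟨κ, ⟨fun e => ⟨?_⟩⟩, fun μ hμ => ?_⟩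
  · rw [Kernel.piecewise_apply]
    split_ifs with h
    · exact h
    · simp
  have : IsProbabilityMeasure (μ.map (embeddingReal α)) :=
    Measure.isProbabilityMeasure_map hf.measurable.aemeasurable
  refine ⟨fun q => cdf (μ.map (embeddingReal α)) q, ?_⟩
  have key : κ₀.comapRight hf (fun q => cdf (μ.map (embeddingReal α)) q) = μ := by
    rw [Kernel.comapRight_apply]
    change ((stieltjesOfMeasurableRat id measurable_id _).measure).comap _ = μ
    rw [measure_stieltjesOfMeasurableRat_cdf, hf.comap_map]
  rw [Kernel.piecewise_apply, if_pos, key]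
  simp [key]

/-- On a standard Borel space finite measures are determined by countably many values. -/
theorem exists_seq_measurableSet_ext (α : Type*) [MeasurableSpace α] [StandardBorelSpace α] :
    ∃ A : ℕ → Set α, (∀ n, MeasurableSet (A n)) ∧ ∀ μ ν : Measure α, IsFiniteMeasure μ →
      (∀ n, μ (A n) = ν (A n)) → μ = ν := by
  have hf := measurableEmbedding_embeddingReal α
  obtain ⟨e, he⟩ := exists_surjective_nat (Option ℚ)
  refine ⟨fun n => (e n).elim univ fun q => embeddingReal α ⁻¹' Iic (q : ℝ), fun n => ?_,
    fun μ ν _ h => ?_⟩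
  · dsimp only
    cases e n with
    | none => exact MeasurableSet.univ
    | some q => exact hf.measurable measurableSet_Iic
  have hu : μ univ = ν univ := by
    obtain ⟨n, hn⟩ := he none
    simpa [hn] using h n
  have hq : ∀ q : ℚ, μ (embeddingReal α ⁻¹' Iic (q : ℝ)) = ν (embeddingReal α ⁻¹' Iic (q : ℝ)) := by
    intro q
    obtain ⟨n, hn⟩ := he (some q)
    simpa [hn] using h n
  have : μ.map (embeddingReal α) = ν.map (embeddingReal α) := by
    refine ext_of_generate_finite _ Real.borel_eq_generateFrom_Iic_rat Real.isPiSystem_Iic_rat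
      ?_ ?_
    · intro s hs
      obtain ⟨q, rfl⟩ := by simpa using hs
      rw [hf.map_apply, hf.map_apply, hq]
    · rw [hf.map_apply, hf.map_apply, preimage_univ, hu]
  rw [← hf.comap_map μ, this, hf.comap_map]

/-! ### Measurability of transport costs and choice of couplings -/

namespace CondOT

variable {α Ω : Type*} [MeasurableSpace α] [MeasurableSpace Ω]

theorem otCost_lt_iff (c : α → α → ℝ≥0) (μ ν : Measure α) (r : ℝ≥0∞) :
    otCost c μ ν < r ↔ ∃ π : Measure (α × α), (π.fst = μ ∧ π.snd = ν) ∧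
      ∫⁻ p, (c p.1 p.2 : ℝ≥0∞) ∂π < r := by
  simp only [otCost, iInf_lt_iff, exists_prop]

theorem otCost_le (c : α → α → ℝ≥0) {μ ν : Measure α} {π : Measure (α × α)}
    (h1 : π.fst = μ) (h2 : π.snd = ν) : otCost c μ ν ≤ ∫⁻ p, (c p.1 p.2 : ℝ≥0∞) ∂π :=
  iInf₂_le π ⟨h1, h2⟩

/-- The marginal constraints become the equation `g e = h ω` between points of a standard Borel
space, so `Ω` itself needs no standard Borel structure. One prescribed marginal already forces `π`
to be a probability measure, hence a value of `κ`. -/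
theorem exists_coupling_encoding [StandardBorelSpace α] [Nonempty α] (μ ν : Kernel Ω α)
    [IsMarkovKernel μ] [IsMarkovKernel ν] :
    ∃ (κ : Kernel (ℚ → ℝ) (α × α)) (g : (ℚ → ℝ) → (ℕ → ℝ≥0∞) × (ℕ → ℝ≥0∞))
      (h : Ω → (ℕ → ℝ≥0∞) × (ℕ → ℝ≥0∞)), IsMarkovKernel κ ∧ Measurable g ∧ Measurable h ∧
      (∀ ω e, g e = h ω ↔ (κ e).fst = μ ω ∧ (κ e).snd = ν ω) ∧
      ∀ ω (π : Measure (α × α)), π.fst = μ ω → ∃ e, κ e = π := by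
  obtain ⟨κ, hκ, hκs⟩ := exists_universal_kernel (α × α)
  obtain ⟨A, hA, hext⟩ := exists_seq_measurableSet_ext α
  refine ⟨κ, fun e => (fun n => (κ e).fst (A n), fun n => (κ e).snd (A n)),
    fun ω => (fun n => μ ω (A n), fun n => ν ω (A n)), hκ, ?_, ?_, fun ω e => ?_,
    fun ω π hπ => hκs π ⟨?_⟩⟩
  · refine Measurable.prodMk (measurable_pi_lambda _ fun n => ?_)
      (measurable_pi_lambda _ fun n => ?_)
    · simp_rw [Measure.fst_apply (hA n)]
      exact κ.measurable_coe (measurable_fst (hA n))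
    · simp_rw [Measure.snd_apply (hA n)]
      exact κ.measurable_coe (measurable_snd (hA n))
  · exact (measurable_pi_lambda _ fun n => μ.measurable_coe (hA n)).prodMk
      (measurable_pi_lambda _ fun n => ν.measurable_coe (hA n))
  · rw [Prod.mk.injEq]
    refine and_congr ⟨fun h => hext _ _ inferInstance (congrFun h), fun h => by rw [h]⟩
      ⟨fun h => hext _ _ inferInstance (congrFun h), fun h => by rw [h]⟩
  · rw [← Measure.fst_univ, hπ, measure_univ]

theorem aemeasurable_otCost [StandardBorelSpace α] [Nonempty α] {c : α → α → ℝ≥0}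
    (hc : Measurable fun p : α × α => c p.1 p.2) (ρ : Measure Ω) [IsFiniteMeasure ρ]
    (μ ν : Kernel Ω α) [IsMarkovKernel μ] [IsMarkovKernel ν] :
    AEMeasurable (fun ω => otCost c (μ ω) (ν ω)) ρ := by
  obtain ⟨κ, g, h, hκ, hg, hh, hgh, hsurj⟩ := exists_coupling_encoding μ ν
  refine NullMeasurable.aemeasurable (measurable_of_Iio (δ := NullMeasurableSpace Ω ρ) fun r => ?_)
  have hcost : Measurable fun e => ∫⁻ p, (c p.1 p.2 : ℝ≥0∞) ∂κ e :=
    Measurable.lintegral_kernel hc.coe_nnreal_ennreal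
  have hA : MeasurableSet {e | ∫⁻ p, (c p.1 p.2 : ℝ≥0∞) ∂κ e < r} := hcost measurableSet_Iio
  have hn := (BaireSection.exists_measurable_section (ρ.map h) hg hA).1.preimage
    (hh.quasiMeasurePreserving ρ)
  change NullMeasurableSet _ ρ
  refine cast (congrArg (NullMeasurableSet · ρ) ?_) hn
  ext ω
  change ω ∈ h ⁻¹' (g '' _) ↔ otCost c (μ ω) (ν ω) < r
  simp only [mem_preimage, otCost_lt_iff, mem_image, mem_ofPred_eq, hgh]
  symm
  constructor
  · rintro ⟨π, hπ, hr⟩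
    obtain ⟨e, rfl⟩ := hsurj ω π hπ.1
    exact ⟨e, hr, hπ⟩
  · rintro ⟨e, hr, hπ⟩
    exact ⟨κ e, hπ, hr⟩

/-- Almost optimal couplings of two kernels can be chosen measurably. -/
theorem exists_kernel_coupling_le [StandardBorelSpace α] [Nonempty α] {c : α → α → ℝ≥0}
    (hc : Measurable fun p : α × α => c p.1 p.2) (ρ : Measure Ω) [IsFiniteMeasure ρ]
    (μ ν : Kernel Ω α) [IsMarkovKernel μ] [IsMarkovKernel ν] {ε : ℝ≥0∞} (hε : ε ≠ 0) :
    ∃ π : Kernel Ω (α × α), IsMarkovKernel π ∧ ∀ᵐ ω ∂ρ, otCost c (μ ω) (ν ω) < ∞ →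
      (π ω).fst = μ ω ∧ (π ω).snd = ν ω ∧
        ∫⁻ p, (c p.1 p.2 : ℝ≥0∞) ∂π ω ≤ otCost c (μ ω) (ν ω) + ε := by
  obtain ⟨κ, g, h, hκ, hg, hh, hgh, hsurj⟩ := exists_coupling_encoding μ ν
  obtain ⟨f, hf, hfe⟩ := aemeasurable_otCost hc ρ μ ν
  have hcost : Measurable fun e => ∫⁻ p, (c p.1 p.2 : ℝ≥0∞) ∂κ e :=
    Measurable.lintegral_kernel hc.coe_nnreal_ennreal
  -- The extra coordinate carries the threshold, which varies with `ω`: the section is evaluated at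
  -- `(h ω, f ω + ε)`.
  have hA : MeasurableSet {q : (ℚ → ℝ) × ℝ≥0∞ | ∫⁻ p, (c p.1 p.2 : ℝ≥0∞) ∂κ q.1 < q.2} :=
    measurableSet_lt (hcost.comp measurable_fst) measurable_snd
  have hH : Measurable fun ω => (h ω, f ω + ε) := hh.prodMk (hf.add_const ε)
  obtain ⟨-, t, ht, hts⟩ := BaireSection.exists_measurable_section
    (ρ.map fun ω => (h ω, f ω + ε)) (hg.prodMap measurable_id) hA
  refine ⟨κ.comap (fun ω => (t (h ω, f ω + ε)).1) (measurable_fst.comp (ht.comp hH)),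
    inferInstance, ?_⟩
  filter_upwards [ae_of_ae_map hH.aemeasurable hts, hfe] with ω hω hfω hfin
  have hlt : otCost c (μ ω) (ν ω) < f ω + ε := by
    rw [← hfω]
    exact ENNReal.lt_add_right hfin.ne hε
  obtain ⟨π, hπ, hr⟩ := (otCost_lt_iff _ _ _ _).1 hlt
  obtain ⟨e, rfl⟩ := hsurj ω π hπ.1
  obtain ⟨h1, h2⟩ := hω ⟨(e, f ω + ε), hr, Prod.ext ((hgh ω e).2 hπ) rfl⟩
  have h3 : g (t (h ω, f ω + ε)).1 = h ω := congrArg Prod.fst h2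
  have h4 : (t (h ω, f ω + ε)).2 = f ω + ε := congrArg Prod.snd h2
  rw [Kernel.comap_apply, hfω]
  refine ⟨((hgh _ _).1 h3).1, ((hgh _ _).1 h3).2, ?_⟩
  have h1 : ∫⁻ p, (c p.1 p.2 : ℝ≥0∞) ∂κ (t (h ω, f ω + ε)).1 < (t (h ω, f ω + ε)).2 := h1
  rw [h4] at h1
  exact h1.le

theorem map_prodMap_id_compProd_comap {α β γ : Type*} [MeasurableSpace α] [MeasurableSpace β]
    [MeasurableSpace γ] (μ : Measure α) [SFinite μ] (κ : Kernel β γ) [IsSFiniteKernel κ]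
    {f : α → β} (hf : Measurable f) :
    (μ ⊗ₘ κ.comap f hf).map (Prod.map f id) = μ.map f ⊗ₘ κ := by
  ext s hs
  have hm : Measurable (Prod.map f (id : γ → γ)) := hf.prodMap measurable_id
  rw [Measure.map_apply hm hs, Measure.compProd_apply (hm hs), Measure.compProd_apply hs,
    lintegral_map (Kernel.measurable_kernel_prodMk_left hs) hf]
  rfl

/-! ### Diagonal coupling and gluing -/

section Cost

variable {𝒳 : Type*} [MeasurableSpace 𝒳]

theorem otCost_self {c : 𝒳 → 𝒳 → ℝ≥0} (hc : Measurable fun p : 𝒳 × 𝒳 => c p.1 p.2)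
    (h0 : ∀ x, c x x = 0) (μ : Measure 𝒳) : otCost c μ μ = 0 := by
  have hd : Measurable fun x : 𝒳 => (x, x) := measurable_id.prodMk measurable_id
  refine le_antisymm ((otCost_le c (π := μ.map fun x => (x, x)) ?_ ?_).trans_eq ?_) zero_le
  · rw [Measure.fst, Measure.map_map measurable_fst hd]; exact Measure.map_id
  · rw [Measure.snd, Measure.map_map measurable_snd hd]; exact Measure.map_id
  · rw [lintegral_map hc.coe_nnreal_ennreal hd]
    simp [h0]

theorem otCost_triangle [StandardBorelSpace 𝒳] [Nonempty 𝒳] {c : 𝒳 → 𝒳 → ℝ≥0}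
    (hc : Measurable fun p : 𝒳 × 𝒳 => c p.1 p.2) (htri : ∀ x y z, c x z ≤ c x y + c y z)
    (μ ν ξ : Measure 𝒳) [IsFiniteMeasure μ] [IsFiniteMeasure ν] :
    otCost c μ ξ ≤ otCost c μ ν + otCost c ν ξ := by
  refine ENNReal.le_iInf₂_add_iInf₂ fun π₁ h₁ π₂ h₂ => ?_
  have : IsFiniteMeasure π₁ := ⟨by rw [← Measure.fst_univ, h₁.1]; exact measure_lt_top _ _⟩
  have : IsFiniteMeasure π₂ := ⟨by rw [← Measure.fst_univ, h₂.1]; exact measure_lt_top _ _⟩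
  -- Gluing: given `(x, y)` drawn from `π₁`, the third point follows the conditional law of `π₂`
  -- given `y`.
  let Γ := π₁ ⊗ₘ π₂.condKernel.comap Prod.snd measurable_snd
  have hΓ₁ : Γ.map Prod.fst = π₁ := Measure.fst_compProd _ _
  have hΓ₂ : Γ.map (Prod.map Prod.snd id) = π₂ := by
    rw [map_prodMap_id_compProd_comap]
    change π₁.snd ⊗ₘ _ = _
    rw [h₁.2, ← h₂.1, π₂.disintegrate]
  have hm₂ : Measurable (Prod.map Prod.snd id : (𝒳 × 𝒳) × 𝒳 → 𝒳 × 𝒳) := by fun_prop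
  have hm : Measurable fun q : (𝒳 × 𝒳) × 𝒳 => (q.1.1, q.2) := by fun_prop
  refine (otCost_le c (π := Γ.map fun q => (q.1.1, q.2)) ?_ ?_).trans ?_
  · rw [← h₁.1, ← hΓ₁, Measure.fst, Measure.fst, Measure.map_map measurable_fst hm,
      Measure.map_map measurable_fst measurable_fst]
    rfl
  · rw [← h₂.2, ← hΓ₂, Measure.snd, Measure.snd, Measure.map_map measurable_snd hm,
      Measure.map_map measurable_snd hm₂]
    rfl
  · have hC := hc.coe_nnreal_ennreal
    rw [lintegral_map hC hm]
    conv_rhs => rw [← hΓ₁, ← hΓ₂, lintegral_map hC measurable_fst, lintegral_map hC hm₂]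
    refine le_of_le_of_eq ?_ (lintegral_add_left (hC.comp measurable_fst) _)
    exact lintegral_mono fun q =>
      ENNReal.coe_le_coe.2 (htri q.1.1 q.1.2 q.2)

end Cost

/-! ### Passing between conditioning on `Y` and on `Z` -/

variable {𝒳 𝒴 𝒵 𝒰 : Type*} [MeasurableSpace 𝒳]
  [MeasurableSpace 𝒴] [MeasurableSpace 𝒵] [MeasurableSpace 𝒰]

theorem exists_kernel_eq_genLaw (PU : Measure 𝒰) [IsProbabilityMeasure PU] {G : 𝒵 × 𝒰 → 𝒳}
    (hG : Measurable G) : ∃ η : Kernel 𝒵 𝒳, IsMarkovKernel η ∧ ∀ z, η z = genLaw G PU z := by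
  refine ⟨(Kernel.id ×ₖ Kernel.const 𝒵 PU).map G, Kernel.IsMarkovKernel.map _ hG, fun z => ?_⟩
  rw [Kernel.map_apply _ hG, Kernel.prod_apply, Kernel.id_apply, Kernel.const_apply,
    Measure.dirac_prod, Measure.map_map hG measurable_prodMk_left]
  rfl

theorem fst_latentJoint (P : Measure (𝒴 × 𝒳)) {Φ : 𝒴 → 𝒵} (hΦ : Measurable Φ) :
    (latentJoint P Φ).fst = P.fst.map Φ := by
  have hm : Measurable fun p : 𝒴 × 𝒳 => (Φ p.1, p.2) := by fun_prop
  rw [latentJoint, Measure.fst, Measure.fst, Measure.map_map measurable_fst hm,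
    Measure.map_map hΦ measurable_fst]
  rfl

variable [StandardBorelSpace 𝒳] [Nonempty 𝒳]

/-- Couplings over `𝒴` can be averaged to couplings over `𝒵`: gluing along `Φ` does not increase
the optimal transport cost. -/
theorem lintegral_otCost_condZ_le {c : 𝒳 → 𝒳 → ℝ≥0}
    (hc : Measurable fun p : 𝒳 × 𝒳 => c p.1 p.2) (P : Measure (𝒴 × 𝒳)) [IsProbabilityMeasure P]
    {Φ : 𝒴 → 𝒵} (hΦ : Measurable Φ) (η : Kernel 𝒵 𝒳) [IsMarkovKernel η] :
    ∫⁻ z, otCost c (condZ P Φ z) (η z) ∂(P.fst.map Φ) ≤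
      ∫⁻ y, otCost c (condY P y) (η (Φ y)) ∂P.fst := by
  have hC := hc.coe_nnreal_ennreal
  have hmeas : AEMeasurable (fun y => otCost c (condY P y) (η (Φ y))) P.fst :=
    aemeasurable_otCost hc P.fst P.condKernel (η.comap Φ hΦ)
  rcases eq_or_ne (∫⁻ y, otCost c (condY P y) (η (Φ y)) ∂P.fst) ∞ with htop | htop
  · rw [htop]; exact le_top
  refine ENNReal.le_of_forall_pos_le_add fun ε hε _ => ?_
  obtain ⟨π, hπM, hπ⟩ := exists_kernel_coupling_le hc P.fst P.condKernel (η.comap Φ hΦ)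
    (ENNReal.coe_ne_zero.2 hε.ne')
  -- A finite integral makes the cost finite almost everywhere, so the selected couplings are valid
  -- almost everywhere.
  replace hπ : ∀ᵐ y ∂P.fst, (π y).fst = P.condKernel y ∧ (π y).snd = η.comap Φ hΦ y ∧
      ∫⁻ p, (c p.1 p.2 : ℝ≥0∞) ∂π y ≤ otCost c (condY P y) (η (Φ y)) + ε := by
    filter_upwards [hπ, ae_lt_top' hmeas htop] with y hy hlt using hy hlt
  have hm : Measurable (Prod.map Φ id : 𝒴 × (𝒳 × 𝒳) → 𝒵 × (𝒳 × 𝒳)) := by fun_prop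
  -- Disintegrating `M` over `𝒵` averages the couplings `π y` over the fibres of `Φ`; its marginals
  -- are identified by almost everywhere uniqueness of disintegrations.
  let M := (P.fst ⊗ₘ π).map (Prod.map Φ id)
  have : IsFiniteMeasure M := by unfold M; infer_instance
  have hM : M.fst = P.fst.map Φ := by
    rw [Measure.fst, Measure.map_map measurable_fst hm]
    change (P.fst ⊗ₘ π).map (Φ ∘ Prod.fst) = _
    rw [← Measure.map_map hΦ measurable_fst]
    congr 1
    exact Measure.fst_compProd _ _
  have hdis : P.fst.map Φ ⊗ₘ M.condKernel = M := by rw [← hM, M.disintegrate]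
  have hmarg : ∀ (w : 𝒳 × 𝒳 → 𝒳) (_ : Measurable w) (κ : Kernel 𝒴 𝒳) [IsMarkovKernel κ],
      (∀ᵐ y ∂P.fst, (π y).map w = κ y) →
      P.fst.map Φ ⊗ₘ M.condKernel.map w = (P.fst ⊗ₘ κ).map (Prod.map Φ id) := by
    intro w hw κ _ h
    have h' : π.map w =ᵐ[P.fst] κ := by
      filter_upwards [h] with y hy
      rw [Kernel.map_apply _ hw, hy]
    rw [Measure.compProd_map hw, hdis, ← Measure.compProd_congr h', Measure.compProd_map hw,
      Measure.map_map (by fun_prop) hm, Measure.map_map (by fun_prop) (by fun_prop)]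
    rfl
  have h1 : ∀ᵐ z ∂(P.fst.map Φ), (M.condKernel z).fst = condZ P Φ z := by
    have h := hmarg Prod.fst measurable_fst P.condKernel (hπ.mono fun y hy => hy.1)
    rw [P.disintegrate] at h
    have : P.map (Prod.map Φ id) = P.fst.map Φ ⊗ₘ (latentJoint P Φ).condKernel := by
      rw [← fst_latentJoint P hΦ, (latentJoint P Φ).disintegrate]
      rfl
    filter_upwards [Kernel.ae_eq_of_compProd_eq (h.trans this)] with z hz
    rw [Kernel.map_apply _ measurable_fst] at hz
    exact hz
  have h2 : ∀ᵐ z ∂(P.fst.map Φ), (M.condKernel z).snd = η z := by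
    have h := hmarg Prod.snd measurable_snd (η.comap Φ hΦ) (hπ.mono fun y hy => hy.2.1)
    rw [map_prodMap_id_compProd_comap] at h
    filter_upwards [Kernel.ae_eq_of_compProd_eq h] with z hz
    rw [Kernel.map_apply _ measurable_snd] at hz
    exact hz
  calc ∫⁻ z, otCost c (condZ P Φ z) (η z) ∂(P.fst.map Φ)
      ≤ ∫⁻ z, ∫⁻ p, (c p.1 p.2 : ℝ≥0∞) ∂M.condKernel z ∂(P.fst.map Φ) := by
        refine lintegral_mono_ae ?_
        filter_upwards [h1, h2] with z hz1 hz2 using otCost_le c hz1 hz2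
    _ = ∫⁻ q, (c q.2.1 q.2.2 : ℝ≥0∞) ∂M := by
        conv_rhs => rw [← hdis]
        exact (Measure.lintegral_compProd (f := fun q : 𝒵 × 𝒳 × 𝒳 => (c q.2.1 q.2.2 : ℝ≥0∞))
          (hC.comp measurable_snd)).symm
    _ = ∫⁻ y, ∫⁻ p, (c p.1 p.2 : ℝ≥0∞) ∂π y ∂P.fst := by
        refine (lintegral_map (f := fun q : 𝒵 × 𝒳 × 𝒳 => (c q.2.1 q.2.2 : ℝ≥0∞))
          (hC.comp measurable_snd) hm).trans ?_
        exact Measure.lintegral_compProd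
          (f := fun q : 𝒴 × 𝒳 × 𝒳 => (c q.2.1 q.2.2 : ℝ≥0∞)) (hC.comp measurable_snd)
    _ ≤ ∫⁻ y, (otCost c (condY P y) (η (Φ y)) + ε) ∂P.fst :=
        lintegral_mono_ae (hπ.mono fun y hy => hy.2.2)
    _ = ∫⁻ y, otCost c (condY P y) (η (Φ y)) ∂P.fst + ε := by
        rw [lintegral_add_right _ measurable_const]
        simp

/-- If `Y` is almost surely a function of `Z = Φ(Y)`, then conditioning on `Y` and on `Z` agree. -/
theorem condY_ae_eq_condZ (P : Measure (𝒴 × 𝒳)) [IsProbabilityMeasure P] {Φ : 𝒴 → 𝒵}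
    (hΦ : Measurable Φ) {GY : 𝒵 → 𝒴} (hGY : Measurable GY)
    (h : ∀ᵐ y ∂P.fst, GY (Φ y) = y) : ∀ᵐ y ∂P.fst, condY P y = condZ P Φ (Φ y) := by
  let κ := (latentJoint P Φ).condKernel.comap Φ hΦ
  -- A measure with first marginal `P.fst` is recovered from its image under `Φ × id`, so it
  -- suffices to compare images in `𝒵 × 𝒳`.
  have hmap : ∀ Q : Measure (𝒴 × 𝒳), Q.fst = P.fst →
      (Q.map (Prod.map Φ id)).map (Prod.map GY id) = Q := by
    intro Q hQ
    rw [Measure.map_map (by fun_prop) (by fun_prop)]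
    conv_rhs => rw [← Measure.map_id (μ := Q)]
    refine Measure.map_congr ?_
    rw [← hQ] at h
    filter_upwards [ae_of_ae_map measurable_fst.aemeasurable h] with p hp
    exact Prod.ext hp rfl
  have hκ : P = P.fst ⊗ₘ κ := by
    refine (hmap P rfl).symm.trans (Eq.trans ?_ (hmap (P.fst ⊗ₘ κ) (Measure.fst_compProd _ _)))
    rw [map_prodMap_id_compProd_comap, ← fst_latentJoint P hΦ,
      (latentJoint P Φ).disintegrate]
    rfl
  filter_upwards [eq_condKernel_of_measure_eq_compProd κ hκ] with y hy
  exact hy.symm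

theorem IsExactEncoder.condY_ae_eq_condZ {P : Measure (𝒴 × 𝒳)} [IsProbabilityMeasure P]
    {PZref : Measure 𝒵} {PU : Measure 𝒰} {Φ : 𝒴 → 𝒵} (hΦ : Measurable Φ)
    (h : IsExactEncoder P PZref PU Φ) : ∀ᵐ y ∂P.fst, condY P y = condZ P Φ (Φ y) := by
  obtain ⟨GY, GX, hGY, -, -, S, hS, hS1, -, hinv⟩ := h
  refine CondOT.condY_ae_eq_condZ P hΦ hGY ?_
  filter_upwards [(mem_ae_iff_prob_eq_one hS).2 hS1] with y hy using hinv y hy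

end CondOT

theorem mainTheorem1 {𝒳 𝒴 𝒵 𝒰 : Type*} [MeasurableSpace 𝒳] [StandardBorelSpace 𝒳] [Nonempty 𝒳]
    [MeasurableSpace 𝒴] [MeasurableSpace 𝒵] [MeasurableSpace 𝒰]
    (c : 𝒳 → 𝒳 → ℝ≥0) (hc : Measurable (fun p : 𝒳 × 𝒳 => c p.1 p.2))
    (P : Measure (𝒴 × 𝒳)) [IsProbabilityMeasure P]
    (PZref : Measure 𝒵) [IsProbabilityMeasure PZref]
    (PU : Measure 𝒰) [IsProbabilityMeasure PU]
    (Φ : 𝒴 → 𝒵) (hΦ : Measurable Φ) (G : 𝒵 × 𝒰 → 𝒳) (hG : Measurable G) :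
    -- the three integrands are measurable up to null sets, so the integrals are meaningful
    (AEMeasurable (fun z => CondOT.otCost c (CondOT.condZ P Φ z) (CondOT.genLaw G PU z))
        (P.fst.map Φ) ∧
      AEMeasurable (fun y => CondOT.otCost c (CondOT.condY P y) (CondOT.genLaw G PU (Φ y)))
        P.fst ∧
      AEMeasurable (fun y => CondOT.otCost c (CondOT.condY P y) (CondOT.condZ P Φ (Φ y)))
        P.fst) ∧
    CondOT.latentCost c P PU G Φ ≤ CondOT.condCost c P PU G Φ ∧
    ((∀ x y z, c x z ≤ c x y + c y z) →
      CondOT.condCost c P PU G Φ ≤ CondOT.latentCost c P PU G Φ + CondOT.reprError c P Φ) ∧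
    (CondOT.IsExactEncoder P PZref PU Φ →
      ((∀ x, c x x = 0) → CondOT.reprError c P Φ = 0) ∧
      CondOT.condCost c P PU G Φ = CondOT.latentCost c P PU G Φ) := by

  have hmY : AEMeasurable (fun y => CondOT.otCost c (CondOT.condY P y) (CondOT.genLaw G PU (Φ y)))
      P.fst := by
    obtain ⟨η, hη, hηG⟩ := CondOT.exists_kernel_eq_genLaw PU hG
    simp_rw [← hηG]
    exact CondOT.aemeasurable_otCost hc P.fst P.condKernel (η.comap Φ hΦ)
  have hmZ : AEMeasurable (fun z => CondOT.otCost c (CondOT.condZ P Φ z) (CondOT.genLaw G PU z))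
      (P.fst.map Φ) := by
    obtain ⟨η, hη, hηG⟩ := CondOT.exists_kernel_eq_genLaw PU hG
    simp_rw [← hηG]
    exact CondOT.aemeasurable_otCost hc (P.fst.map Φ) (CondOT.latentJoint P Φ).condKernel η
  have hmE : AEMeasurable (fun y => CondOT.otCost c (CondOT.condY P y) (CondOT.condZ P Φ (Φ y)))
      P.fst :=
    CondOT.aemeasurable_otCost hc P.fst P.condKernel
      ((CondOT.latentJoint P Φ).condKernel.comap Φ hΦ)
  -- Written over `𝒴`, the latent cost can be compared pointwise with the other two integrands.
  have hlat : CondOT.latentCost c P PU G Φ =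
      ∫⁻ y, CondOT.otCost c (CondOT.condZ P Φ (Φ y)) (CondOT.genLaw G PU (Φ y)) ∂P.fst :=
    lintegral_map' hmZ hΦ.aemeasurable
  refine ⟨⟨hmZ, hmY, hmE⟩, ?_, fun htri => ?_, fun hex => ⟨fun h0 => ?_, ?_⟩⟩
  · obtain ⟨η, hη, hηG⟩ := CondOT.exists_kernel_eq_genLaw PU hG
    simp_rw [CondOT.latentCost, CondOT.condCost, ← hηG]
    exact CondOT.lintegral_otCost_condZ_le hc P hΦ η
  · rw [hlat, add_comm, CondOT.reprError, ← lintegral_add_left' hmE]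
    refine lintegral_mono fun y => ?_
    have : IsProbabilityMeasure (CondOT.condY P y) := by unfold CondOT.condY; infer_instance
    have : IsProbabilityMeasure (CondOT.condZ P Φ (Φ y)) := by
      unfold CondOT.condZ; infer_instance
    exact CondOT.otCost_triangle hc htri _ _ _
  · refine (lintegral_congr_ae ?_).trans lintegral_zero
    filter_upwards [hex.condY_ae_eq_condZ hΦ] with y hy
    rw [hy, CondOT.otCost_self hc h0]
  · rw [hlat]
    refine lintegral_congr_ae ?_
    filter_upwards [hex.condY_ae_eq_condZ hΦ] with y hy
    rw [hy]
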